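/- Let $c>0$ and let $\lambda\in C^2\bigl((0,\infty),[0,\infty)\bigr)$ (integrability of $\lambda$ near $0$ is not assumed). Let $N$ be a Poisson process on $(0,\infty)$ with rate function $\lambda$, and write $N(s,t]$ for the number of its events in $(s,t]$. *Standard orthogonal planar motion.* Put $d_k=(\cos(k\pi/2),\sin(k\pi/2))$ for $k\in\mathbb Z/4$. Let $D(t)$, $t\ge0$, be a direction process with $D(0)$ independent of $N$ and uniform on $\{d_0,d_1,d_2,d_3\}$, which is constant between the events of $N$ and which, at each event of $N$, switches from the current direction $d_k$ to $d_{k+1}$ or $d_{k-1}$ with probability $1/2$ each, whatever the past. Put $(X(t),Y(t))=\int_0^t c\,D(s)\,ds$ for $t\ge0$. *Three-velocity motion.* Let $V(t)$, $t\ge0$, be a process with values in $\{c,0,-c\}$, with $V(0)$ independent of the Poisson process and equal to $c,0,-c$ with probabilities $1/4,1/2,1/4$, which is constant between the events of a Poisson process with the same rate function $\lambda$ and which, at each event, switches from $\pm c$ to $0$ with probability $1$, and from $0$ to $c$ or to $-c$ with probability $1/2$ each, whatever the past. Put $\mathcal T(t)=\int_0^tV(s)\,ds$ for $t\ge0$.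 Here the events of the Poisson process after time $s$ are independent of the history of the motion and of the events up to time $s$, for every $s\ge 0$; and the switching rule means that, conditionally on this history and on $N(s,t]=1$, the state at time $t$ is obtained from the state at time $s$ by one switch. Then each of the processes $\{X(t)\}_{t\ge0}$ and $\{Y(t)\}_{t\ge0}$ is equal in distribution to the process $\{\mathcal T(t)\}_{t\ge0}$; that is, each has the same law as $\mathcal T$ on $\mathbb R^{[0,\infty)}$, equivalently the same finite-dimensional distributions. -/

import Mathlib

open MeasureTheory ProbabilityTheory Set
open scoped ENNReal NNReal

noncomputable section

namespace OrthogonalMotion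

/-- The mass at `n` of the Poisson law with mean `m ∈ [0, ∞]`. For `m = ∞` this law is concentrated
at the value `∞`, so that every natural number has mass `0`. -/
def poissonMass (m : ℝ≥0∞) (n : ℕ) : ℝ≥0∞ :=
  if m = ∞ then 0 else poissonMeasure m.toNNReal {n}

/-- `Λ(s, t) = ∫ₛᵗ lam(u) du ∈ [0, ∞]`, which may be infinite for `s = 0`. -/
def cumulativeRate (lam : ℝ → ℝ) (s t : ℝ) : ℝ≥0∞ :=
  ∫⁻ u in Ioc s t, ENNReal.ofReal (lam u)

section Switching

variable {Ω : Type*} {E : Type*}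

/-- `N(s, t]`: the number of event times in `(s, t]`, where `S ω` is the random set of event times.
In particular `N(t) = N(0, t]`. -/
def eventCount (S : Ω → Set ℝ) (s t : ℝ) (ω : Ω) : ℕ∞ :=
  (S ω ∩ Ioc s t).encard

/-- The σ-algebra generated by the states `Z(u)`, `0 ≤ u ≤ s`, and by the counts `N(u, v]`,
`0 ≤ u ≤ v ≤ s`. -/
abbrev history (S : Ω → Set ℝ) (Z : ℝ → Ω → E) (s : ℝ) : MeasurableSpace Ω :=
  MeasurableSpace.generateFrom
    ({A | ∃ u, 0 ≤ u ∧ u ≤ s ∧ ∃ x : E, A = {ω | Z u ω = x}} ∪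
      {A | ∃ u v, 0 ≤ u ∧ u ≤ v ∧ v ≤ s ∧ ∃ n : ℕ, A = {ω | eventCount S u v ω = n}})

/-- The state process `(Z(t))_{t ≥ 0}` has initial law `init` and is paced by the Poisson process
with rate function `lam` whose random set of event times is `S`: it is constant between event
times, and at each event time it switches according to the transition probabilities `sw`. -/
structure IsPoissonSwitching [MeasurableSpace Ω] (P : Measure Ω) (lam : ℝ → ℝ)
    (init : E → ℝ≥0∞) (sw : E → E → ℝ≥0∞) (S : Ω → Set ℝ) (Z : ℝ → Ω → E) : Prop where
  measurableSet_state : ∀ t, 0 ≤ t → ∀ x : E, MeasurableSet {ω | Z t ω = x}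
  measurableSet_count : ∀ s t, 0 ≤ s → s ≤ t → ∀ n : ℕ, MeasurableSet {ω | eventCount S s t ω = n}
  /-- `N(s, t]` has the Poisson law with mean `Λ(s, t)`. -/
  count_law : ∀ s t, 0 ≤ s → s ≤ t → ∀ n : ℕ,
    P {ω | eventCount S s t ω = n} = poissonMass (cumulativeRate lam s t) n
  /-- `N(s, t]` is independent of the history up to time `s`. For `s = 0` the history is generated
  by the initial state. -/
  count_indep : ∀ s t, 0 ≤ s → s ≤ t → ∀ A, MeasurableSet[history S Z s] A → ∀ n : ℕ,
    P (A ∩ {ω | eventCount S s t ω = n}) = P A * P {ω | eventCount S s t ω = n}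
  init_law : ∀ x : E, P {ω | Z 0 ω = x} = init x
  /-- The state does not change on an interval without events. -/
  const_between : ∀ᵐ ω ∂P, ∀ s t, 0 ≤ s → s ≤ t → S ω ∩ Ioc s t = ∅ → Z t ω = Z s ω
  /-- `P(Z(t) = y | Z(s) = x, N(s, t] = 1, A) = sw x y` for every event `A` of the history up to
  time `s`, in product form. -/
  switch : ∀ s t, 0 ≤ s → s ≤ t → ∀ A, MeasurableSet[history S Z s] A → ∀ x y : E,
    P (A ∩ {ω | Z s ω = x} ∩ {ω | eventCount S s t ω = 1} ∩ {ω | Z t ω = y}) =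
      sw x y * P (A ∩ {ω | Z s ω = x} ∩ {ω | eventCount S s t ω = 1})

end Switching

/-- The direction `d_k = (cos (kπ/2), sin (kπ/2))`. -/
def direction (k : ZMod 4) : ℝ × ℝ :=
  (Real.cos ((k.val : ℝ) * Real.pi / 2), Real.sin ((k.val : ℝ) * Real.pi / 2))

/-- From `d_k` the particle switches to `d_{k+1}` or `d_{k-1}`, each with probability `1/2`. -/
def orthogonalSwitch (k l : ZMod 4) : ℝ≥0∞ :=
  if l = k + 1 ∨ l = k - 1 then 1 / 2 else 0

/-- `(R(t))_{t ≥ 0}`, with `R(t) = (X(t), Y(t))`, is a standard orthogonal planar motion with speed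
`c` and rate function `lam`: it starts at the origin and moves with velocity `c • d_{D(t)}`, where
`D(0)` is uniform on the four directions and `D` switches to one of the two orthogonal directions,
with probability `1/2` each, at the events of the Poisson process. -/
def IsStandardOrthogonalMotion {Ω : Type*} [MeasurableSpace Ω] (P : Measure Ω) (c : ℝ)
    (lam : ℝ → ℝ) (R : ℝ → Ω → ℝ × ℝ) : Prop :=
  ∃ (S : Ω → Set ℝ) (D : ℝ → Ω → ZMod 4),
    IsPoissonSwitching P lam (fun _ => 1 / 4) orthogonalSwitch S D ∧
      ∀ᵐ ω ∂P, ∀ t, 0 ≤ t → R t ω = ∫ s in (0 : ℝ)..t, c • direction (D s ω)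

/-- The law of `V(0)/c`: the values `1`, `0`, `-1` have probabilities `1/4`, `1/2`, `1/4`. -/
def threeVelocityInit (x : SignType) : ℝ≥0∞ :=
  if x = 0 then 1 / 2 else 1 / 4

/-- From velocity `0` the process switches to `c` or `-c` with probability `1/2` each; from
velocity `±c` it switches to `0` with probability `1`. -/
def threeVelocitySwitch (x y : SignType) : ℝ≥0∞ :=
  if x = 0 then (if y = 0 then 0 else 1 / 2) else (if y = 0 then 1 else 0)

/-- `(T(t))_{t ≥ 0}` is the three-velocity motion `T(t) = ∫₀ᵗ V(s) ds` with velocities `c, 0, -c`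
and rate function `lam`; here `V(s) = c σ(s)` with `σ(s) ∈ {1, 0, -1}`. -/
def IsThreeVelocityMotion {Ω : Type*} [MeasurableSpace Ω] (P : Measure Ω) (c : ℝ)
    (lam : ℝ → ℝ) (T : ℝ → Ω → ℝ) : Prop :=
  ∃ (S : Ω → Set ℝ) (σ : ℝ → Ω → SignType),
    IsPoissonSwitching P lam threeVelocityInit threeVelocitySwitch S σ ∧
      ∀ᵐ ω ∂P, ∀ t, 0 ≤ t → T t ω = ∫ s in (0 : ℝ)..t, c * (σ s ω : ℝ)

end OrthogonalMotion

end

/-! A horizontal direction always turns to a vertical one, and a vertical direction turns to each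
horizontal one with probability 1/2. Hence each coordinate sign of `D` switches by the
three-velocity rule, is paced by the same event set, and has initial law 1/4, 1/2, 1/4
(`IsPoissonSwitching.map`). It remains to show that the rate determines the law of a three-velocity
motion.

The switching matrix on the three states has eigenvalues 1, 0, -1, and its eigenfunctions span all
functions. By the forward equation, the mean of an eigenfunction with eigenvalue `r`, restricted to
a past event, is multiplied by `exp (-(1 - r) ∫ lam)` between positive times
(`sum_mul_measureReal_eq_exp_mul`). The two contrasts have mean zero initially, and this persists at
all positive times: if the rate is integrable at 0 by continuity there, and otherwise because the
exponential factor vanishes in the limit (`sum_mul_measureReal_eq_zero`). So all finite-dimensional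
laws at positive times agree (`measureReal_cylinder_eq`).

Almost every path has locally finitely many events in the open half-line, so its integral is the
limit of grid approximations. The displacement is therefore a measurable functional of the state
path at positive times, and equality in law carries over (`identDistrib_displacement`). -/

open Filter Topology

namespace OrthogonalMotion

/-! ### Histories and images of switching processes -/

section History

variable {Ω : Type*} {E : Type*} {S : Ω → Set ℝ} {Z : ℝ → Ω → E}

theorem history_mono {s t : ℝ} (hst : s ≤ t) : history S Z s ≤ history S Z t := by
  refine MeasurableSpace.generateFrom_mono (union_subset_union ?_ ?_)
  · rintro A ⟨u, hu, hus, x, rfl⟩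
    exact ⟨u, hu, hus.trans hst, x, rfl⟩
  · rintro A ⟨u, v, hu, huv, hvs, n, rfl⟩
    exact ⟨u, v, hu, huv, hvs.trans hst, n, rfl⟩

theorem measurableSet_history_state {u s : ℝ} (hu : 0 ≤ u) (hus : u ≤ s) (x : E) :
    MeasurableSet[history S Z s] {ω | Z u ω = x} :=
  MeasurableSpace.measurableSet_generateFrom (Or.inl ⟨u, hu, hus, x, rfl⟩)

/-- Projecting the state coarsens the history, so independence and the switching rule, assumed for
the finer history, pass to the image process. -/
theorem history_map_le [Finite E] {E' : Type*} (π : E → E') (s : ℝ) :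
    history S (fun t ω => π (Z t ω)) s ≤ history S Z s := by
  refine MeasurableSpace.generateFrom_le ?_
  rintro A (⟨u, hu, hus, x, rfl⟩ | ⟨u, v, hu, huv, hvs, n, rfl⟩)
  · have : {ω | π (Z u ω) = x} = ⋃ k ∈ {k | π k = x}, {ω | Z u ω = k} := by
      ext ω; simp
    rw [this]
    exact MeasurableSet.biUnion (Set.to_countable _)
      fun k _ => measurableSet_history_state hu hus k
  · exact MeasurableSpace.measurableSet_generateFrom (Or.inr ⟨u, v, hu, huv, hvs, n, rfl⟩)

end History

theorem measure_inter_comp_eq_sum {Ω E E' : Type*} [MeasurableSpace Ω] (P : Measure Ω)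
    [Fintype E] [DecidableEq E'] {z : Ω → E} (hz : ∀ x, MeasurableSet {ω | z ω = x})
    {B : Set Ω} (hB : MeasurableSet B) (π : E → E') (y : E') :
    P (B ∩ {ω | π (z ω) = y}) = ∑ l, if π l = y then P (B ∩ {ω | z ω = l}) else 0 := by
  rw [← Finset.sum_filter, ← measure_biUnion_finset]
  · congr 1
    ext ω; simp
  · intro k _ l _ hkl
    refine Set.disjoint_left.2 fun ω h h' => hkl ?_
    exact h.2.symm.trans h'.2
  · exact fun l _ => hB.inter (hz l)

theorem poissonMass_ofReal {h : ℝ} (hh : 0 ≤ h) (n : ℕ) :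
    poissonMass (ENNReal.ofReal h) n =
      ENNReal.ofReal (Real.exp (-h) * h ^ n / n.factorial) := by
  have : (ENNReal.toNNReal (ENNReal.ofReal h) : ℝ) = h := by
    rw [ENNReal.coe_toNNReal_eq_toReal, ENNReal.toReal_ofReal hh]
  rw [poissonMass, if_neg ENNReal.ofReal_ne_top, poissonMeasure_singleton, this]

namespace IsPoissonSwitching

variable {Ω : Type*} {E : Type*} [MeasurableSpace Ω] {P : Measure Ω} {lam : ℝ → ℝ}
  {init : E → ℝ≥0∞} {sw : E → E → ℝ≥0∞} {S : Ω → Set ℝ} {Z : ℝ → Ω → E}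

theorem history_le (hZ : IsPoissonSwitching P lam init sw S Z) (s : ℝ) :
    history S Z s ≤ ‹MeasurableSpace Ω› := by
  refine MeasurableSpace.generateFrom_le ?_
  rintro A (⟨u, hu, -, x, rfl⟩ | ⟨u, v, hu, huv, -, n, rfl⟩)
  · exact hZ.measurableSet_state u hu x
  · exact hZ.measurableSet_count u v hu huv n

/-- A function of the state whose switching rule depends on the state only through its value is
again a switching process. -/
theorem map [Fintype E] {E' : Type*} [DecidableEq E'] {init' : E' → ℝ≥0∞}
    {sw' : E' → E' → ℝ≥0∞} (hZ : IsPoissonSwitching P lam init sw S Z) (π : E → E')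
    (hinit : ∀ x, init' x = ∑ k, if π k = x then init k else 0)
    (hsw : ∀ k y, sw' (π k) y = ∑ l, if π l = y then sw k l else 0) :
    IsPoissonSwitching P lam init' sw' S (fun t ω => π (Z t ω)) where
  measurableSet_state t ht x := history_le hZ t _
    (history_map_le π t _ (measurableSet_history_state ht le_rfl x))
  measurableSet_count := hZ.measurableSet_count
  count_law := hZ.count_law
  count_indep s t hs hst A hA n := hZ.count_indep s t hs hst A (history_map_le π s A hA) n
  init_law x := by
    have := measure_inter_comp_eq_sum P (hZ.measurableSet_state 0 le_rfl) MeasurableSet.univ π x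
    simp only [univ_inter] at this
    rw [this, hinit]
    simp only [hZ.init_law]
  const_between := by
    filter_upwards [hZ.const_between] with ω hω s t hs hst h
    rw [hω s t hs hst h]
  switch s t hs hst A hA x y := by
    have hA' := history_map_le π s A hA
    have hAm := history_le hZ s A hA'
    have ht := hs.trans hst
    have hN : MeasurableSet {ω | eventCount S s t ω = 1} := by
      simpa using hZ.measurableSet_count s t hs hst 1
    have hY : MeasurableSet {ω | π (Z t ω) = y} := history_le hZ t _
      (history_map_le π t _ (measurableSet_history_state ht le_rfl y))
    have e1 : A ∩ {ω | π (Z s ω) = x} ∩ {ω | eventCount S s t ω = 1} ∩ {ω | π (Z t ω) = y} =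
        A ∩ {ω | eventCount S s t ω = 1} ∩ {ω | π (Z t ω) = y} ∩ {ω | π (Z s ω) = x} := by
      ext; simp only [mem_inter_iff]; tauto
    have e2 : A ∩ {ω | π (Z s ω) = x} ∩ {ω | eventCount S s t ω = 1} =
        A ∩ {ω | eventCount S s t ω = 1} ∩ {ω | π (Z s ω) = x} := by
      ext; simp only [mem_inter_iff]; tauto
    rw [e1, e2, measure_inter_comp_eq_sum P (hZ.measurableSet_state s hs) ((hAm.inter hN).inter hY),
      measure_inter_comp_eq_sum P (hZ.measurableSet_state s hs) (hAm.inter hN), Finset.mul_sum]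
    -- The probability is split over the fibre of `x`, then over that of `y`; by `hsw` the total
    -- rate from `k` into the fibre of `y` depends only on `π k`.
    refine Finset.sum_congr rfl fun k _ => ?_
    split_ifs with hk
    · have e3 : A ∩ {ω | eventCount S s t ω = 1} ∩ {ω | π (Z t ω) = y} ∩ {ω | Z s ω = k} =
          A ∩ {ω | Z s ω = k} ∩ {ω | eventCount S s t ω = 1} ∩ {ω | π (Z t ω) = y} := by
        ext; simp only [mem_inter_iff]; tauto
      have e4 : A ∩ {ω | eventCount S s t ω = 1} ∩ {ω | Z s ω = k} =
          A ∩ {ω | Z s ω = k} ∩ {ω | eventCount S s t ω = 1} := by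
        ext; simp only [mem_inter_iff]; tauto
      rw [e3, e4, measure_inter_comp_eq_sum P (hZ.measurableSet_state t ht)
        ((hAm.inter (hZ.measurableSet_state s hs k)).inter hN), ← hk, hsw, Finset.sum_mul]
      refine Finset.sum_congr rfl fun l _ => ?_
      split_ifs
      · exact hZ.switch s t hs hst A hA' k l
      · simp
    · simp

/-- The Kolmogorov forward equation in integrated form, up to a second-order error. -/
theorem abs_measureReal_state_sub_le [Fintype E] [DecidableEq E] [IsProbabilityMeasure P]
    (hZ : IsPoissonSwitching P lam init sw S Z) {u v h : ℝ} (hu : 0 ≤ u) (huv : u ≤ v)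
    (hh : 0 ≤ h) (hlam : cumulativeRate lam u v = ENNReal.ofReal h) {A : Set Ω}
    (hA : MeasurableSet[history S Z u] A) (y : E) :
    |P.real (A ∩ {ω | Z v ω = y}) - (Real.exp (-h) * P.real (A ∩ {ω | Z u ω = y}) +
      h * Real.exp (-h) * ∑ x, (sw x y).toReal * P.real (A ∩ {ω | Z u ω = x}))| ≤ h ^ 2 := by
  have hv := hu.trans huv
  have hAm := history_le hZ u A hA
  set N0 : Set Ω := {ω | eventCount S u v ω = 0} with hN0
  set N1 : Set Ω := {ω | eventCount S u v ω = 1} with hN1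
  have hN0m : MeasurableSet N0 := by
    rw [hN0]; simpa using hZ.measurableSet_count u v hu huv 0
  have hN1m : MeasurableSet N1 := by
    rw [hN1]; simpa using hZ.measurableSet_count u v hu huv 1
  have hdisj : Disjoint N0 N1 := by
    refine Set.disjoint_left.2 fun ω h0 h1 => ?_
    simp only [hN0, hN1, mem_ofPred_eq] at h0 h1
    simp [h0] at h1
  have hp0 : P N0 = ENNReal.ofReal (Real.exp (-h)) := by
    have := hZ.count_law u v hu huv 0
    rw [hlam, poissonMass_ofReal hh] at this
    simpa using this
  have hp1 : P N1 = ENNReal.ofReal (h * Real.exp (-h)) := by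
    have := hZ.count_law u v hu huv 1
    rw [hlam, poissonMass_ofReal hh] at this
    simpa [mul_comm] using this
  have hAx : ∀ x, MeasurableSet[history S Z u] (A ∩ {ω | Z u ω = x}) := fun x =>
    MeasurableSet.inter hA (measurableSet_history_state hu le_rfl x)
  have i0 : ∀ x, P.real (A ∩ {ω | Z u ω = x} ∩ N0) =
      Real.exp (-h) * P.real (A ∩ {ω | Z u ω = x}) := fun x => by
    have := hZ.count_indep u v hu huv _ (hAx x) 0
    rw [Nat.cast_zero] at this
    rw [measureReal_def, this, ENNReal.toReal_mul, hp0,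
      ENNReal.toReal_ofReal (Real.exp_nonneg _), mul_comm, measureReal_def]
  have i1 : ∀ x, P.real (A ∩ {ω | Z u ω = x} ∩ N1) =
      h * Real.exp (-h) * P.real (A ∩ {ω | Z u ω = x}) := fun x => by
    have := hZ.count_indep u v hu huv _ (hAx x) 1
    rw [Nat.cast_one] at this
    rw [measureReal_def, this, ENNReal.toReal_mul, hp1,
      ENNReal.toReal_ofReal (by positivity), mul_comm, measureReal_def]
  set B : Set Ω := A ∩ {ω | Z v ω = y} with hB
  have hBm : MeasurableSet B := hAm.inter (hZ.measurableSet_state v hv y)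
  have j0 : P.real (B ∩ N0) = P.real (A ∩ {ω | Z u ω = y} ∩ N0) := by
    refine measureReal_congr ?_
    filter_upwards [hZ.const_between] with ω hω
    refine propext ?_
    change (ω ∈ A ∧ Z v ω = y) ∧ eventCount S u v ω = 0 ↔
      (ω ∈ A ∧ Z u ω = y) ∧ eventCount S u v ω = 0
    refine and_congr_left fun h0 => ?_
    rw [hω u v hu huv (encard_eq_zero.1 h0)]
  have j1 : P.real (B ∩ N1) =
      h * Real.exp (-h) * ∑ x, (sw x y).toReal * P.real (A ∩ {ω | Z u ω = x}) := by
    -- With the constant map to `Unit` the decomposition becomes the law of total probability over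
    -- the state at time `u`.
    have key := measure_inter_comp_eq_sum P (hZ.measurableSet_state u hu) (hBm.inter hN1m)
      (fun _ => ()) ()
    simp only [ofPred_true, inter_univ, if_true] at key
    rw [measureReal_def, key, ENNReal.toReal_sum fun x _ => measure_ne_top _ _, Finset.mul_sum]
    refine Finset.sum_congr rfl fun x _ => ?_
    have e : B ∩ N1 ∩ {ω | Z u ω = x} =
        A ∩ {ω | Z u ω = x} ∩ N1 ∩ {ω | Z v ω = y} := by
      ext; simp only [hB, mem_inter_iff]; tauto
    rw [e, hZ.switch u v hu huv A hA x y, ENNReal.toReal_mul, ← measureReal_def, i1 x]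
    ring
  have d1 : P.real B = P.real (B ∩ N0) + P.real (B ∩ N1) + P.real (B \ (N0 ∪ N1)) := by
    rw [← measureReal_inter_add_sdiff (s := B) (hN0m.union hN1m), inter_union_distrib_left,
      measureReal_union (hdisj.mono inter_subset_right inter_subset_right) (hBm.inter hN1m)]
  have d2 : P.real (B \ (N0 ∪ N1)) ≤ h ^ 2 := by
    have h1 : P.real (B \ (N0 ∪ N1)) ≤ P.real (N0 ∪ N1)ᶜ :=
      measureReal_mono fun ω hω => hω.2
    rw [probReal_compl_eq_one_sub (hN0m.union hN1m), measureReal_union hdisj hN1m,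
      measureReal_def (s := N0), measureReal_def (s := N1), hp0, hp1, ENNReal.toReal_ofReal (Real.exp_nonneg _),
      ENNReal.toReal_ofReal (by positivity)] at h1
    -- Two or more events have probability `1 - (1 + h) exp (-h) ≤ 1 - (1 + h) (1 - h) = h ^ 2`.
    have h2 := Real.add_one_le_exp (-h)
    nlinarith
  rw [d1, j0, i0, j1]
  have := measureReal_nonneg (μ := P) (s := B \ (N0 ∪ N1))
  rw [add_sub_cancel_left, abs_of_nonneg this]
  exact d2

end IsPoissonSwitching

end OrthogonalMotion

/-! ### Exponential decay of eigenfunctions between positive times -/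

namespace OrthogonalMotion

/-- Quadratically small increments force a zero derivative. This turns the second-order error of one
time step into an exact identity. -/
theorem eqOn_const_of_abs_sub_le_sq {f : ℝ → ℝ} {a b C : ℝ}
    (hf : ∀ u v, a ≤ u → u ≤ v → v ≤ b → |f v - f u| ≤ C * (v - u) ^ 2) :
    ∀ x ∈ Icc a b, f x = f a := by
  have key : ∀ x ∈ Icc a b, HasDerivWithinAt f 0 (Icc a b) x := by
    intro x hx
    rw [hasDerivWithinAt_iff_isLittleO]
    have h1 : (fun y => f y - f x - (y - x) • (0 : ℝ)) =O[𝓝[Icc a b] x]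
        fun y => (y - x) ^ 2 := by
      refine Asymptotics.IsBigO.of_bound C ?_
      filter_upwards [self_mem_nhdsWithin] with y hy
      simp only [smul_zero, sub_zero, Real.norm_eq_abs, abs_pow, sq_abs]
      rcases le_total x y with h | h
      · exact hf x y hx.1 h hy.2
      · rw [abs_sub_comm, sub_sq_comm]
        exact hf y x hy.1 h hx.2
    refine h1.trans_isLittleO ?_
    refine Asymptotics.IsLittleO.mono ?_ (nhdsWithin_le_nhds)
    exact (Asymptotics.isLittleO_pow_sub_sub x one_lt_two).congr_left fun y => by simp
  refine constant_of_has_deriv_right_zero (fun x hx => (key x hx).continuousWithinAt) ?_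
  intro x hx
  exact (key x ⟨hx.1, hx.2.le⟩).mono_of_mem_nhdsWithin (Icc_mem_nhdsGE_of_mem hx)

/-- Compares the first-order factor `exp (-h) (1 + h r)` with the exact `exp (-(1 - r) h)`. For `h ≤
1` this is a Taylor bound; for `h ≥ 1` the crude bound `2 + h ≤ 3 h ^ 2` suffices. -/
theorem abs_one_add_mul_sub_exp_mul_le {h r : ℝ} (hh : 0 ≤ h) (hr : |r| ≤ 1) :
    Real.exp (-h) * |1 + h * r - Real.exp (h * r)| ≤ 3 * h ^ 2 := by
  have hr' := abs_le.1 hr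
  have e1 : Real.exp (-h) ≤ 1 := Real.exp_le_one_iff.2 (by linarith)
  rcases le_total h 1 with h1 | h1
  · have hx : |h * r| ≤ 1 := by
      rw [abs_mul, abs_of_nonneg hh]; nlinarith [abs_nonneg r]
    have := Real.abs_exp_sub_one_sub_id_le hx
    have e2 : |1 + h * r - Real.exp (h * r)| ≤ (h * r) ^ 2 := by
      rw [abs_sub_comm]; convert this using 2; ring
    have e3 : (h * r) ^ 2 ≤ h ^ 2 := by
      rw [mul_pow, ← sq_abs r]
      exact mul_le_of_le_one_right (sq_nonneg h) (pow_le_one₀ (abs_nonneg r) hr)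
    calc Real.exp (-h) * |1 + h * r - Real.exp (h * r)|
        ≤ 1 * h ^ 2 := mul_le_mul e1 (e2.trans e3) (abs_nonneg _) zero_le_one
      _ ≤ _ := by nlinarith [sq_nonneg h]
  · have e2 : Real.exp (-h) * Real.exp (h * r) ≤ 1 := by
      rw [← Real.exp_add]
      exact Real.exp_le_one_iff.2 (by nlinarith)
    have e3 : |1 + h * r - Real.exp (h * r)| ≤ 1 + h + Real.exp (h * r) := by
      rw [abs_le]
      have := Real.exp_pos (h * r)
      constructor <;> nlinarith
    calc Real.exp (-h) * |1 + h * r - Real.exp (h * r)|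
        ≤ Real.exp (-h) * (1 + h + Real.exp (h * r)) := by gcongr
      _ = Real.exp (-h) * (1 + h) + Real.exp (-h) * Real.exp (h * r) := by ring
      _ ≤ 1 * (1 + h) + 1 := by gcongr
      _ ≤ _ := by nlinarith

section Rate

variable {lam : ℝ → ℝ}

theorem cumulativeRate_eq_ofReal (hc : ContinuousOn lam (Ioi 0)) (h0 : ∀ t, 0 < t → 0 ≤ lam t)
    {u v : ℝ} (hu : 0 < u) (huv : u ≤ v) :
    cumulativeRate lam u v = ENNReal.ofReal (∫ x in u..v, lam x) := by
  have hint : IntegrableOn lam (Ioc u v) :=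
    ((hc.mono fun x hx => hu.trans_le hx.1).integrableOn_Icc).mono_set Ioc_subset_Icc_self
  rw [cumulativeRate, intervalIntegral.integral_of_le huv,
    ofReal_integral_eq_lintegral_ofReal hint]
  filter_upwards [ae_restrict_mem measurableSet_Ioc] with x hx using h0 x (hu.trans hx.1)

theorem intervalIntegrable_rate (hc : ContinuousOn lam (Ioi 0)) {u v : ℝ} (hu : 0 < u)
    (hv : 0 < v) : IntervalIntegrable lam volume u v :=
  (hc.mono fun _ hx => (lt_min hu hv).trans_le hx.1).intervalIntegrable

theorem integral_rate_nonneg (h0 : ∀ t, 0 < t → 0 ≤ lam t) {u v : ℝ} (hu : 0 < u) (huv : u ≤ v) :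
    0 ≤ ∫ x in u..v, lam x :=
  intervalIntegral.integral_nonneg huv fun x hx => h0 x (hu.trans_le hx.1)

theorem exists_integral_rate_le (hc : ContinuousOn lam (Ioi 0)) {s : ℝ} (hs : 0 < s) (t : ℝ) :
    ∃ B, 0 ≤ B ∧ ∀ u v, s ≤ u → u ≤ v → v ≤ t → ∫ x in u..v, lam x ≤ B * (v - u) := by
  obtain ⟨B, hB⟩ := isCompact_Icc.exists_bound_of_continuousOn
    (hc.mono (fun x hx => hs.trans_le hx.1 : Icc s t ⊆ Ioi 0))
  refine ⟨max B 0, le_max_right _ _, fun u v hu huv hv => ?_⟩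
  have := intervalIntegral.norm_integral_le_of_norm_le_const (f := lam) (a := u) (b := v)
    (C := max B 0) fun x hx => by
      rw [uIoc_of_le huv] at hx
      exact (hB x ⟨hu.trans hx.1.le, hx.2.trans hv⟩).trans (le_max_left _ _)
  rw [abs_of_nonneg (sub_nonneg.2 huv)] at this
  exact (le_abs_self _).trans this

end Rate

namespace IsPoissonSwitching

variable {Ω : Type*} {E : Type*} [MeasurableSpace Ω] {P : Measure Ω} {lam : ℝ → ℝ}
  {init : E → ℝ≥0∞} {sw : E → E → ℝ≥0∞} {S : Ω → Set ℝ} {Z : ℝ → Ω → E}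

/-- The forward equation tested against an eigenfunction: each state contributes an error `h ^ 2`,
and replacing the linear factor by the exponential costs `3 h ^ 2` times the number of states. -/
theorem abs_sum_mul_measureReal_sub_le [Fintype E] [DecidableEq E] [IsProbabilityMeasure P]
    (hZ : IsPoissonSwitching P lam init sw S Z) {f : E → ℝ} {r : ℝ} (hr : |r| ≤ 1)
    (hf : ∀ y, |f y| ≤ 1) (hfr : ∀ x, ∑ y, (sw x y).toReal * f y = r * f x)
    {u v h : ℝ} (hu : 0 ≤ u) (huv : u ≤ v)
    (hh : 0 ≤ h) (hlam : cumulativeRate lam u v = ENNReal.ofReal h) {A : Set Ω}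
    (hA : MeasurableSet[history S Z u] A) :
    |∑ y, f y * P.real (A ∩ {ω | Z v ω = y}) -
      Real.exp (-((1 - r) * h)) * ∑ y, f y * P.real (A ∩ {ω | Z u ω = y})| ≤
      4 * Fintype.card E * h ^ 2 := by
  set p : E → ℝ := fun y => P.real (A ∩ {ω | Z u ω = y}) with hp
  set q : E → ℝ := fun y => P.real (A ∩ {ω | Z v ω = y}) with hq
  have hp1 : ∀ y, |p y| ≤ 1 := fun y => by
    rw [abs_of_nonneg measureReal_nonneg]; exact measureReal_le_one
  have hpq : ∀ y, |q y - (Real.exp (-h) * p y + h * Real.exp (-h) *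
      ∑ x, (sw x y).toReal * p x)| ≤ h ^ 2 :=
    fun y => hZ.abs_measureReal_state_sub_le hu huv hh hlam hA y
  have e1 : ∑ y, f y * ∑ x, (sw x y).toReal * p x = r * ∑ y, f y * p y := by
    simp_rw [Finset.mul_sum]
    rw [Finset.sum_comm]
    refine Finset.sum_congr rfl fun x _ => ?_
    calc ∑ y, f y * ((sw x y).toReal * p x) = (∑ y, (sw x y).toReal * f y) * p x := by
          rw [Finset.sum_mul]; exact Finset.sum_congr rfl fun y _ => by ring
      _ = _ := by rw [hfr]; ring
  have e2 : Real.exp (-((1 - r) * h)) = Real.exp (-h) * Real.exp (h * r) := by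
    rw [← Real.exp_add]; congr 1; ring
  have e3 : ∑ y, f y * q y - Real.exp (-((1 - r) * h)) * ∑ y, f y * p y =
      ∑ y, f y * (q y - (Real.exp (-h) * p y + h * Real.exp (-h) *
        ∑ x, (sw x y).toReal * p x)) +
      Real.exp (-h) * (1 + h * r - Real.exp (h * r)) * ∑ y, f y * p y := by
    have : ∑ y, f y * (q y - (Real.exp (-h) * p y + h * Real.exp (-h) *
        ∑ x, (sw x y).toReal * p x)) = ∑ y, f y * q y - Real.exp (-h) * ∑ y, f y * p y -
        h * Real.exp (-h) * ∑ y, f y * ∑ x, (sw x y).toReal * p x := by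
      rw [Finset.mul_sum, Finset.mul_sum, ← Finset.sum_sub_distrib, ← Finset.sum_sub_distrib]
      exact Finset.sum_congr rfl fun y _ => by ring
    rw [this, e1, e2]; ring
  have b1 : |∑ y, f y * (q y - (Real.exp (-h) * p y + h * Real.exp (-h) *
      ∑ x, (sw x y).toReal * p x))| ≤ Fintype.card E * h ^ 2 := by
    refine (Finset.abs_sum_le_sum_abs _ _).trans ?_
    rw [← nsmul_eq_mul, ← Finset.card_univ]
    refine Finset.sum_le_card_nsmul _ _ _ fun y _ => ?_
    rw [abs_mul]
    exact (mul_le_mul (hf y) (hpq y) (abs_nonneg _) zero_le_one).trans_eq (one_mul _)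
  have b2 : |∑ y, f y * p y| ≤ Fintype.card E := by
    refine (Finset.abs_sum_le_sum_abs _ _).trans ?_
    rw [← nsmul_one, ← Finset.card_univ]
    refine Finset.sum_le_card_nsmul _ _ _ fun y _ => ?_
    rw [abs_mul]
    exact (mul_le_mul (hf y) (hp1 y) (abs_nonneg _) zero_le_one).trans_eq (one_mul _)
  have b3 := abs_one_add_mul_sub_exp_mul_le hh hr
  rw [e3]
  refine (abs_add_le _ _).trans ?_
  rw [abs_mul, abs_mul, Real.abs_exp]
  calc _ ≤ Fintype.card E * h ^ 2 + 3 * h ^ 2 * Fintype.card E :=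
        add_le_add b1 (mul_le_mul b3 b2 (abs_nonneg _) (by positivity))
    _ = _ := by ring

/-- An eigenfunction of the switching matrix, with eigenvalue `r`, decays exponentially. -/
theorem sum_mul_measureReal_eq_exp_mul [Fintype E] [DecidableEq E] [IsProbabilityMeasure P]
    (hZ : IsPoissonSwitching P lam init sw S Z)
    (hc : ContinuousOn lam (Ioi 0)) (h0 : ∀ t, 0 < t → 0 ≤ lam t) {f : E → ℝ} {r : ℝ}
    (hr : |r| ≤ 1) (hf : ∀ y, |f y| ≤ 1) (hfr : ∀ x, ∑ y, (sw x y).toReal * f y = r * f x)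
    {s t : ℝ} (hs : 0 < s) (hst : s ≤ t) {A : Set Ω} (hA : MeasurableSet[history S Z s] A) :
    ∑ y, f y * P.real (A ∩ {ω | Z t ω = y}) =
      Real.exp (-((1 - r) * ∫ x in s..t, lam x)) * ∑ y, f y * P.real (A ∩ {ω | Z s ω = y}) := by
  have hr1 : 0 ≤ 1 - r := by linarith [(abs_le.1 hr).2]
  obtain ⟨B, hB0, hB⟩ := exists_integral_rate_le hc hs t
  set g : ℝ → ℝ := fun u => ∑ y, f y * P.real (A ∩ {ω | Z u ω = y}) with hg
  set L : ℝ → ℝ := fun u => ∫ x in s..u, lam x with hL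
  set G : ℝ → ℝ := fun u => Real.exp ((1 - r) * L u) * g u with hG
  have hLt : 0 ≤ L t := integral_rate_nonneg h0 hs hst
  have key : ∀ u v, s ≤ u → u ≤ v → v ≤ t → |G v - G u| ≤
      Real.exp ((1 - r) * L t) * (4 * Fintype.card E * B ^ 2) * (v - u) ^ 2 := by
    intro u v hsu huv hvt
    have hu := hs.trans_le hsu
    have hv := hu.trans_le huv
    have hLv : L v = L u + ∫ x in u..v, lam x :=
      (intervalIntegral.integral_add_adjacent_intervals (intervalIntegrable_rate hc hs hu)
        (intervalIntegrable_rate hc hu hv)).symm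
    have hLvt : L v ≤ L t := by
      have : L t = L v + ∫ x in v..t, lam x :=
        (intervalIntegral.integral_add_adjacent_intervals (intervalIntegrable_rate hc hs hv)
          (intervalIntegrable_rate hc hv (hv.trans_le hvt))).symm
      linarith [integral_rate_nonneg h0 hv hvt]
    have hh := integral_rate_nonneg h0 hu huv
    have hhB := hB u v hsu huv hvt
    have step := hZ.abs_sum_mul_measureReal_sub_le hr hf hfr hu.le huv hh
      (cumulativeRate_eq_ofReal hc h0 hu huv) (history_mono hsu A hA)
    set h := ∫ x in u..v, lam x
    -- `exp ((1 - r) L)` is the integrating factor, so an increment of `G` is a one-step error,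
    -- quadratic in `v - u` because `lam` is bounded on `[s, t]`.
    have e : G v - G u = Real.exp ((1 - r) * L v) *
        (g v - Real.exp (-((1 - r) * h)) * g u) := by
      have : Real.exp ((1 - r) * L u) =
          Real.exp ((1 - r) * L v) * Real.exp (-((1 - r) * h)) := by
        rw [← Real.exp_add, hLv]; congr 1; ring
      simp only [hG]
      rw [this]; ring
    rw [e, abs_mul, Real.abs_exp, mul_assoc]
    refine mul_le_mul (Real.exp_le_exp.2 (by gcongr)) (step.trans ?_) (abs_nonneg _)
      (Real.exp_nonneg _)
    calc 4 * (Fintype.card E : ℝ) * h ^ 2 ≤ 4 * Fintype.card E * (B * (v - u)) ^ 2 := by gcongr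
      _ = _ := by ring
  have hconst := eqOn_const_of_abs_sub_le_sq key t ⟨hst, le_rfl⟩
  have hGs : G s = g s := by simp [hG, hL]
  rw [hGs] at hconst
  change g t = Real.exp (-((1 - r) * L t)) * g s
  rw [← hconst, hG, ← mul_assoc, ← Real.exp_add]
  simp

end IsPoissonSwitching

end OrthogonalMotion

/-! ### Behaviour at time zero -/

namespace OrthogonalMotion

section Rate

variable {lam : ℝ → ℝ}

theorem tendsto_cumulativeRate_left {t : ℝ} (ht : 0 < t) :
    Tendsto (fun n : ℕ => cumulativeRate lam (t / (n + 1)) t) atTop (𝓝 (cumulativeRate lam 0 t)) := by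
  have e : ∀ s, cumulativeRate lam s t =
      (volume.withDensity fun u => ENNReal.ofReal (lam u)) (Ioc s t) := fun s =>
    (withDensity_apply _ measurableSet_Ioc).symm
  have hmono : Monotone fun n : ℕ => Ioc (t / (n + 1 : ℝ)) t := by
    intro m n hmn
    refine Ioc_subset_Ioc_left ?_
    gcongr
  have hU : ⋃ n : ℕ, Ioc (t / (n + 1 : ℝ)) t = Ioc 0 t := by
    ext x
    simp only [mem_iUnion, mem_Ioc]
    constructor
    · rintro ⟨n, h1, h2⟩
      exact ⟨lt_trans (by positivity) h1, h2⟩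
    · rintro ⟨h1, h2⟩
      obtain ⟨n, hn⟩ := exists_nat_gt (t / x)
      refine ⟨n, ?_, h2⟩
      rw [div_lt_iff₀ h1] at hn
      rw [div_lt_iff₀ (by positivity)]
      nlinarith
  simp only [e]
  rw [← hU]
  exact tendsto_measure_iUnion_atTop hmono

theorem tendsto_cumulativeRate_zero {t : ℝ} (ht : 0 < t) (hfin : cumulativeRate lam 0 t ≠ ∞) :
    Tendsto (fun n : ℕ => cumulativeRate lam 0 (t / (n + 1))) atTop (𝓝 0) := by
  have hlim : Tendsto (fun n : ℕ => t / ((n : ℝ) + 1)) atTop (𝓝 0) :=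
    tendsto_const_div_atTop_nhds_zero_nat t |>.comp (tendsto_add_atTop_nat 1) |>.congr
      fun n => by simp
  have hvol : Tendsto ((volume.restrict (Ioc 0 t)) ∘ fun n : ℕ => Ioc 0 (t / ((n : ℝ) + 1)))
      atTop (𝓝 0) := by
    have h1 : Tendsto (fun n : ℕ => ENNReal.ofReal (t / ((n : ℝ) + 1))) atTop (𝓝 0) := by
      simpa using ENNReal.tendsto_ofReal hlim
    refine tendsto_of_tendsto_of_tendsto_of_le_of_le tendsto_const_nhds h1
      (fun _ => zero_le) fun n => ?_
    refine (Measure.restrict_apply_le _ _).trans ?_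
    simp
  refine (tendsto_setLIntegral_zero hfin hvol).congr fun n => ?_
  rw [cumulativeRate, Measure.restrict_restrict measurableSet_Ioc, Ioc_inter_Ioc]
  congr 3
  · simp
  · exact min_eq_left (div_le_self ht.le (by linarith [n.cast_nonneg (α := ℝ)]))

end Rate

namespace IsPoissonSwitching

variable {Ω : Type*} {E : Type*} [MeasurableSpace Ω] {P : Measure Ω} {lam : ℝ → ℝ}
  {init : E → ℝ≥0∞} {sw : E → E → ℝ≥0∞} {S : Ω → Set ℝ} {Z : ℝ → Ω → E}

/-- An eigenfunction of the switching matrix with eigenvalue below `1` that has mean zero under the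
initial law has mean zero at every positive time, even if the rate is not integrable at `0`. -/
theorem sum_mul_measureReal_eq_zero [Fintype E] [DecidableEq E] [IsProbabilityMeasure P]
    (hZ : IsPoissonSwitching P lam init sw S Z)
    (hc : ContinuousOn lam (Ioi 0)) (h0 : ∀ t, 0 < t → 0 ≤ lam t) {f : E → ℝ} {r : ℝ}
    (hr : |r| ≤ 1) (hr1 : r < 1) (hf : ∀ y, |f y| ≤ 1)
    (hfr : ∀ x, ∑ y, (sw x y).toReal * f y = r * f x)
    (hinit : ∑ y, f y * (init y).toReal = 0) {t : ℝ} (ht : 0 < t) :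
    ∑ y, f y * P.real {ω | Z t ω = y} = 0 := by
  set g : ℝ → ℝ := fun u => ∑ y, f y * P.real {ω | Z u ω = y} with hg
  set s : ℕ → ℝ := fun n => t / (n + 1) with hs
  have hs0 : ∀ n, 0 < s n := fun n => by positivity
  have hst : ∀ n, s n ≤ t := fun n => div_le_self ht.le (by linarith [n.cast_nonneg (α := ℝ)])
  have step : ∀ n, g t = Real.exp (-((1 - r) * ∫ x in s n..t, lam x)) * g (s n) := fun n => by
    have := hZ.sum_mul_measureReal_eq_exp_mul hc h0 hr hf hfr (hs0 n) (hst n)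
      (A := univ) MeasurableSet.univ
    simpa only [univ_inter] using this
  have hL : ∀ n, 0 ≤ ∫ x in s n..t, lam x := fun n => integral_rate_nonneg h0 (hs0 n) (hst n)
  change g t = 0
  -- With infinite mass near 0 the factor from `s n` to `t` tends to 0 while `g` stays bounded. With
  -- finite mass, `g (s n)` is within a one-step error of `g 0 = 0`, and that error vanishes as `s n
  -- → 0`.
  by_cases hfin : cumulativeRate lam 0 t = ∞
  · have hg1 : ∀ u, |g u| ≤ Fintype.card E := fun u => by
      refine (Finset.abs_sum_le_sum_abs _ _).trans ?_
      rw [← nsmul_one, ← Finset.card_univ]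
      refine Finset.sum_le_card_nsmul _ _ _ fun y _ => ?_
      rw [abs_mul, abs_of_nonneg measureReal_nonneg]
      exact mul_le_one₀ (hf y) measureReal_nonneg measureReal_le_one
    have h1 : Tendsto (fun n => ∫ x in s n..t, lam x) atTop atTop := by
      have := tendsto_cumulativeRate_left (lam := lam) ht
      rw [hfin] at this
      rw [← ENNReal.tendsto_ofReal_nhds_top]
      exact this.congr fun n => cumulativeRate_eq_ofReal hc h0 (hs0 n) (hst n)
    have h2 : Tendsto (fun n => Real.exp (-((1 - r) * ∫ x in s n..t, lam x)) * Fintype.card E)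
        atTop (𝓝 0) := by
      rw [← zero_mul (Fintype.card E : ℝ)]
      exact (Real.tendsto_exp_neg_atTop_nhds_zero.comp
        (h1.const_mul_atTop (sub_pos.2 hr1))).mul_const _
    refine abs_nonpos_iff.1 (ge_of_tendsto' h2 fun n => ?_)
    rw [step n, abs_mul, Real.abs_exp]
    gcongr
    exact hg1 _
  · set h : ℕ → ℝ := fun n => (cumulativeRate lam 0 (s n)).toReal with hh
    have hne : ∀ n, cumulativeRate lam 0 (s n) ≠ ∞ := fun n =>
      ne_top_of_le_ne_top hfin (lintegral_mono_set (Ioc_subset_Ioc_right (hst n)))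
    have h1 : Tendsto (fun n => 4 * Fintype.card E * h n ^ 2) atTop (𝓝 0) := by
      have : Tendsto h atTop (𝓝 0) := by
        rw [← ENNReal.toReal_zero]
        exact (ENNReal.tendsto_toReal ENNReal.zero_ne_top).comp
          (tendsto_cumulativeRate_zero ht hfin)
      simpa using (this.pow 2).const_mul (4 * (Fintype.card E : ℝ))
    have hg0 : g 0 = 0 := by
      refine Eq.trans ?_ hinit
      exact Finset.sum_congr rfl fun y _ => by rw [measureReal_def, hZ.init_law]
    refine abs_nonpos_iff.1 (ge_of_tendsto' h1 fun n => ?_)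
    have := hZ.abs_sum_mul_measureReal_sub_le hr hf hfr le_rfl (hs0 n).le
      ENNReal.toReal_nonneg (ENNReal.ofReal_toReal (hne n)).symm (A := univ) MeasurableSet.univ
    simp only [univ_inter] at this
    change |g (s n) - _ * g 0| ≤ _ at this
    rw [hg0, mul_zero, sub_zero] at this
    refine le_trans ?_ this
    rw [step n, abs_mul, Real.abs_exp]
    refine mul_le_of_le_one_left (abs_nonneg _) (Real.exp_le_one_iff.2 ?_)
    have := mul_nonneg (sub_pos.2 hr1).le (hL n)
    linarith

end IsPoissonSwitching

end OrthogonalMotion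

instance SignType.instMeasurableSpace : MeasurableSpace SignType := ⊤

instance SignType.instDiscreteMeasurableSpace : DiscreteMeasurableSpace SignType :=
  ⟨fun _ => trivial⟩

/-! ### Uniqueness of the law of the three-velocity state process -/

namespace OrthogonalMotion

theorem _root_.SignType.sum_univ {M : Type*} [AddCommMonoid M] (g : SignType → M) :
    ∑ x, g x = g 0 + (g 1 + g (-1)) := by
  have : (Finset.univ : Finset SignType) = {0, 1, -1} := by decide
  rw [this, Finset.sum_insert (by decide), Finset.sum_insert (by decide), Finset.sum_singleton]

/-- The eigenfunction of the three-velocity switching matrix with eigenvalue `-1`. -/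
def zeroContrast (x : SignType) : ℝ := if x = 0 then 1 else -1

/-- The eigenfunction of the three-velocity switching matrix with eigenvalue `0`. -/
def signContrast (x : SignType) : ℝ := (x : ℝ)

theorem abs_zeroContrast_le (x : SignType) : |zeroContrast x| ≤ 1 := by
  unfold zeroContrast; split_ifs <;> simp

theorem abs_signContrast_le (x : SignType) : |signContrast x| ≤ 1 := by
  rcases x with _ | _ | _ <;> simp [signContrast]

theorem threeVelocitySwitch_zeroContrast (x : SignType) :
    ∑ y, (threeVelocitySwitch x y).toReal * zeroContrast y = -1 * zeroContrast x := by
  rw [SignType.sum_univ]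
  by_cases hx : x = 0
  · subst hx
    norm_num [threeVelocitySwitch, zeroContrast]
  · norm_num [threeVelocitySwitch, zeroContrast, hx]

theorem threeVelocitySwitch_signContrast (x : SignType) :
    ∑ y, (threeVelocitySwitch x y).toReal * signContrast y = 0 * signContrast x := by
  rw [SignType.sum_univ]
  by_cases hx : x = 0
  · subst hx
    norm_num [threeVelocitySwitch, signContrast]
  · norm_num [threeVelocitySwitch, signContrast, hx]

/-- A function on the three states is determined by its total and its two contrasts. -/
theorem eq_of_contrasts_eq {p q : SignType → ℝ} (h1 : ∑ y, p y = ∑ y, q y)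
    (h2 : ∑ y, zeroContrast y * p y = ∑ y, zeroContrast y * q y)
    (h3 : ∑ y, signContrast y * p y = ∑ y, signContrast y * q y) : p = q := by
  simp only [SignType.sum_univ, zeroContrast, signContrast] at h1 h2 h3
  simp at h1 h2 h3
  funext y
  rcases y with _ | _ | _
  · change p 0 = q 0; linarith
  · change p (-1) = q (-1); linarith
  · change p 1 = q 1; linarith

section Cylinder

variable {Ω E : Type*}

theorem setOf_forall_mem_insert (W : ℝ → Ω → E) (x : Ioi (0 : ℝ) → E) (t : Ioi (0 : ℝ))
    (I : Finset (Ioi (0 : ℝ))) :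
    {ω | ∀ u ∈ insert t I, W u ω = x u} =
      {ω | ∀ u ∈ I, W u ω = x u} ∩ {ω | W t ω = x t} := by
  ext ω
  simp only [Finset.mem_insert, forall_eq_or_imp, mem_inter_iff, mem_ofPred_eq]
  tauto

theorem measurableSet_history_cylinder {S : Ω → Set ℝ} {W : ℝ → Ω → E} {I : Finset (Ioi (0 : ℝ))}
    {s : Ioi (0 : ℝ)} (hs : ∀ u ∈ I, u ≤ s) (x : Ioi (0 : ℝ) → E) :
    MeasurableSet[history S W s] {ω | ∀ u ∈ I, W u ω = x u} := by
  have : {ω | ∀ u ∈ I, W u ω = x u} = ⋂ u ∈ I, {ω | W u ω = x u} := by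
    ext ω; simp
  rw [this]
  exact Finset.measurableSet_biInter I fun u hu =>
    measurableSet_history_state (le_of_lt u.2) (hs u hu) (x u)

theorem preimage_restrict_singleton (W : ℝ → Ω → E) (I : Finset (Ioi (0 : ℝ)))
    {x : Ioi (0 : ℝ) → E} {a : I → E} (hx : ∀ u : I, x u = a u) :
    (I.restrict ∘ fun ω (t : Ioi (0 : ℝ)) => W t ω) ⁻¹' {a} = {ω | ∀ u ∈ I, W u ω = x u} := by
  ext ω
  simp only [mem_preimage, mem_singleton_iff, funext_iff, mem_ofPred_eq]
  exact ⟨fun h u hu => (h ⟨u, hu⟩).trans (hx ⟨u, hu⟩).symm,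
    fun h u => (h u u.2).trans (hx u)⟩

end Cylinder

namespace IsPoissonSwitching

theorem sum_measureReal_state {Ω E : Type*} [Fintype E] [DecidableEq E] [MeasurableSpace Ω]
    {P : Measure Ω} [IsFiniteMeasure P] {lam : ℝ → ℝ} {init : E → ℝ≥0∞} {sw : E → E → ℝ≥0∞}
    {S : Ω → Set ℝ} {Z : ℝ → Ω → E} (hZ : IsPoissonSwitching P lam init sw S Z) {t : ℝ}
    (ht : 0 ≤ t) {A : Set Ω} (hA : MeasurableSet A) :
    ∑ y, P.real (A ∩ {ω | Z t ω = y}) = P.real A := by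
  have key := measure_inter_comp_eq_sum P (hZ.measurableSet_state t ht) hA (fun _ => ()) ()
  simp only [ofPred_true, inter_univ, if_true] at key
  rw [measureReal_def, key, ENNReal.toReal_sum fun x _ => measure_ne_top _ _]
  rfl

section Uniqueness

variable {Ω Ω' : Type*} [MeasurableSpace Ω] [MeasurableSpace Ω'] {P : Measure Ω} {P' : Measure Ω'}
  [IsProbabilityMeasure P] [IsProbabilityMeasure P'] {lam : ℝ → ℝ} {S : Ω → Set ℝ}
  {S' : Ω' → Set ℝ} {Z : ℝ → Ω → SignType} {Z' : ℝ → Ω' → SignType}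

theorem measureReal_state_eq
    (hZ : IsPoissonSwitching P lam threeVelocityInit threeVelocitySwitch S Z)
    (hZ' : IsPoissonSwitching P' lam threeVelocityInit threeVelocitySwitch S' Z')
    (hc : ContinuousOn lam (Ioi 0)) (h0 : ∀ t, 0 < t → 0 ≤ lam t) {t : ℝ} (ht : 0 < t)
    (y : SignType) : P.real {ω | Z t ω = y} = P'.real {ω | Z' t ω = y} := by
  have i1 : ∑ y, zeroContrast y * (threeVelocityInit y).toReal = 0 := by
    rw [SignType.sum_univ]; norm_num [zeroContrast, threeVelocityInit]
  have i2 : ∑ y, signContrast y * (threeVelocityInit y).toReal = 0 := by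
    rw [SignType.sum_univ]; norm_num [signContrast, threeVelocityInit]
  refine congrFun (eq_of_contrasts_eq (p := fun y => P.real {ω | Z t ω = y})
    (q := fun y => P'.real {ω | Z' t ω = y}) ?_ ?_ ?_) y
  · have a := hZ.sum_measureReal_state ht.le MeasurableSet.univ
    have b := hZ'.sum_measureReal_state ht.le MeasurableSet.univ
    simp only [univ_inter, probReal_univ] at a b
    rw [a, b]
  · rw [hZ.sum_mul_measureReal_eq_zero hc h0 (by simp) (by norm_num) abs_zeroContrast_le
        threeVelocitySwitch_zeroContrast i1 ht,
      hZ'.sum_mul_measureReal_eq_zero hc h0 (by simp) (by norm_num) abs_zeroContrast_le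
        threeVelocitySwitch_zeroContrast i1 ht]
  · rw [hZ.sum_mul_measureReal_eq_zero hc h0 (by simp) (by norm_num) abs_signContrast_le
        threeVelocitySwitch_signContrast i2 ht,
      hZ'.sum_mul_measureReal_eq_zero hc h0 (by simp) (by norm_num) abs_signContrast_le
        threeVelocitySwitch_signContrast i2 ht]

/-- The Markov step: both contrasts decay at rates depending only on `lam`, and the total mass is
preserved. -/
theorem measureReal_inter_state_eq
    (hZ : IsPoissonSwitching P lam threeVelocityInit threeVelocitySwitch S Z)
    (hZ' : IsPoissonSwitching P' lam threeVelocityInit threeVelocitySwitch S' Z')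
    (hc : ContinuousOn lam (Ioi 0)) (h0 : ∀ t, 0 < t → 0 ≤ lam t) {s t : ℝ} (hs : 0 < s)
    (hst : s ≤ t) {A : Set Ω} {A' : Set Ω'} (hA : MeasurableSet[history S Z s] A)
    (hA' : MeasurableSet[history S' Z' s] A')
    (h : ∀ y, P.real (A ∩ {ω | Z s ω = y}) = P'.real (A' ∩ {ω | Z' s ω = y})) (y : SignType) :
    P.real (A ∩ {ω | Z t ω = y}) = P'.real (A' ∩ {ω | Z' t ω = y}) := by
  refine congrFun (eq_of_contrasts_eq (p := fun y => P.real (A ∩ {ω | Z t ω = y}))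
    (q := fun y => P'.real (A' ∩ {ω | Z' t ω = y})) ?_ ?_ ?_) y
  · rw [hZ.sum_measureReal_state (hs.le.trans hst) (hZ.history_le s A hA),
      hZ'.sum_measureReal_state (hs.le.trans hst) (hZ'.history_le s A' hA'),
      ← hZ.sum_measureReal_state hs.le (hZ.history_le s A hA),
      ← hZ'.sum_measureReal_state hs.le (hZ'.history_le s A' hA')]
    simp only [h]
  · rw [hZ.sum_mul_measureReal_eq_exp_mul hc h0 (by simp) abs_zeroContrast_le
        threeVelocitySwitch_zeroContrast hs hst hA,
      hZ'.sum_mul_measureReal_eq_exp_mul hc h0 (by simp) abs_zeroContrast_le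
        threeVelocitySwitch_zeroContrast hs hst hA']
    simp only [h]
  · rw [hZ.sum_mul_measureReal_eq_exp_mul hc h0 (by simp) abs_signContrast_le
        threeVelocitySwitch_signContrast hs hst hA,
      hZ'.sum_mul_measureReal_eq_exp_mul hc h0 (by simp) abs_signContrast_le
        threeVelocitySwitch_signContrast hs hst hA']
    simp only [h]

/-- Induction on the latest time. The event at earlier times lies in the history up to their maximum
`s` and fixes the state at `s`, so its intersection with a state at `s` is itself or empty. -/
theorem measureReal_cylinder_eq
    (hZ : IsPoissonSwitching P lam threeVelocityInit threeVelocitySwitch S Z)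
    (hZ' : IsPoissonSwitching P' lam threeVelocityInit threeVelocitySwitch S' Z')
    (hc : ContinuousOn lam (Ioi 0)) (h0 : ∀ t, 0 < t → 0 ≤ lam t) (x : Ioi (0 : ℝ) → SignType)
    (I : Finset (Ioi (0 : ℝ))) :
    P.real {ω | ∀ u ∈ I, Z u ω = x u} = P'.real {ω | ∀ u ∈ I, Z' u ω = x u} := by
  induction I using Finset.induction_on_max with
  | empty => simp
  | insert t I hI ih =>
    rw [setOf_forall_mem_insert, setOf_forall_mem_insert]
    rcases I.eq_empty_or_nonempty with rfl | hne
    · simpa using hZ.measureReal_state_eq hZ' hc h0 t.2 (x t)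
    · have hs := I.max'_mem hne
      set s := I.max' hne with hsdef
      refine hZ.measureReal_inter_state_eq hZ' hc h0 s.2 (hI s hs).le
        (measurableSet_history_cylinder (fun u hu => I.le_max' u hu) x)
        (measurableSet_history_cylinder (fun u hu => I.le_max' u hu) x) (fun y => ?_) (x t)
      by_cases hy : y = x s
      · rw [inter_eq_left.2 fun ω hω => (hω s hs).trans hy.symm,
          inter_eq_left.2 fun ω hω => (hω s hs).trans hy.symm, ih]
      · have e : {ω | ∀ u ∈ I, Z u ω = x u} ∩ {ω | Z s ω = y} = ∅ :=
          eq_empty_of_forall_notMem fun ω hω => hy (hω.2.symm.trans (hω.1 s hs))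
        have e' : {ω | ∀ u ∈ I, Z' u ω = x u} ∩ {ω | Z' s ω = y} = ∅ :=
          eq_empty_of_forall_notMem fun ω hω => hy (hω.2.symm.trans (hω.1 s hs))
        rw [e, e', measureReal_empty, measureReal_empty]

/-- The law of a three-velocity state process on the positive times is unique. -/
theorem identDistrib_path
    (hZ : IsPoissonSwitching P lam threeVelocityInit threeVelocitySwitch S Z)
    (hZ' : IsPoissonSwitching P' lam threeVelocityInit threeVelocitySwitch S' Z')
    (hc : ContinuousOn lam (Ioi 0)) (h0 : ∀ t, 0 < t → 0 ≤ lam t) :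
    IdentDistrib (fun ω (t : Ioi (0 : ℝ)) => Z t ω) (fun ω (t : Ioi (0 : ℝ)) => Z' t ω) P P' := by
  have hm : Measurable fun ω (t : Ioi (0 : ℝ)) => Z t ω := measurable_pi_lambda _ fun t =>
    measurable_to_countable' fun y => hZ.measurableSet_state t (le_of_lt t.2) y
  have hm' : Measurable fun ω (t : Ioi (0 : ℝ)) => Z' t ω := measurable_pi_lambda _ fun t =>
    measurable_to_countable' fun y => hZ'.measurableSet_state t (le_of_lt t.2) y
  refine ⟨hm.aemeasurable, hm'.aemeasurable, ?_⟩
  have hfin : ∀ I : Finset (Ioi (0 : ℝ)), P.map (fun ω => I.restrict fun t => Z t ω) =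
      P'.map (fun ω => I.restrict fun t => Z' t ω) := fun I => by
    have mI := (Finset.measurable_restrict I).comp hm
    have mI' := (Finset.measurable_restrict I).comp hm'
    refine Measure.ext_of_singleton fun a => ?_
    -- The value 0 off `I` is arbitrary; only the coordinates in `I` enter the cylinder.
    let x : Ioi (0 : ℝ) → SignType := fun u => if hu : u ∈ I then a ⟨u, hu⟩ else 0
    have hx : ∀ u : I, x u = a u := fun u => by simp [x]
    have key := hZ.measureReal_cylinder_eq hZ' hc h0 x I
    rw [measureReal_def, measureReal_def,
      ENNReal.toReal_eq_toReal_iff' (measure_ne_top _ _) (measure_ne_top _ _)] at key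
    refine (Measure.map_apply mI (measurableSet_singleton a)).trans ?_
    refine Eq.trans ?_ (Measure.map_apply mI' (measurableSet_singleton a)).symm
    exact (congrArg P (preimage_restrict_singleton Z I hx)).trans
      (key.trans (congrArg P' (preimage_restrict_singleton Z' I hx)).symm)
  have l := isProjectiveLimit_map (P := P) (X := fun (t : Ioi (0 : ℝ)) ω => Z t ω) hm.aemeasurable
  have l' := isProjectiveLimit_map (P := P') (X := fun (t : Ioi (0 : ℝ)) ω => Z' t ω)
    hm'.aemeasurable
  simp_rw [hfin] at l
  exact l.unique l'

end Uniqueness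

end IsPoissonSwitching

end OrthogonalMotion

/-! ### The displacement as a measurable functional of the path -/

namespace OrthogonalMotion

/-- A path that, from every positive time on, keeps its value for a while. -/
def IsRightLocallyConst {E : Type*} (z : ℝ → E) : Prop :=
  ∀ s, 0 < s → ∃ ε, 0 < ε ∧ ∀ u, s ≤ u → u ≤ s + ε → z u = z s

/-- The `k`-th point of the grid of mesh `1 / (n + 1)` on the positive half-line. -/
noncomputable def gridTime (n k : ℕ) : Ioi (0 : ℝ) :=
  ⟨((k : ℝ) + 1) / (n + 1), mem_Ioi.2 (div_pos k.cast_add_one_pos n.cast_add_one_pos)⟩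

/-- The index of the first grid point after time `s`. -/
noncomputable def gridIndex (n : ℕ) (s : ℝ) : ℕ := ⌊((n : ℝ) + 1) * s⌋₊

theorem measurable_gridIndex (n : ℕ) : Measurable (gridIndex n) :=
  Nat.measurable_floor.comp (measurable_const_mul _)

theorem IsRightLocallyConst.eventually_gridTime_eq {E : Type*} {z : ℝ → E}
    (hz : IsRightLocallyConst z) {s : ℝ} (hs : 0 < s) :
    ∀ᶠ n in atTop, z (gridTime n (gridIndex n s)) = z s := by
  obtain ⟨ε, hε, h⟩ := hz s hs
  obtain ⟨m, hm⟩ := exists_nat_gt (1 / ε)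
  filter_upwards [eventually_ge_atTop m] with n hn
  have hn0 : (0 : ℝ) < n + 1 := by positivity
  have h1 := Nat.lt_floor_add_one (((n : ℝ) + 1) * s)
  have h2 := Nat.floor_le (mul_nonneg hn0.le hs.le)
  have h3 : 1 < ε * (n + 1) := by
    rw [div_lt_iff₀ hε] at hm
    have : (m : ℝ) ≤ n := by exact_mod_cast hn
    nlinarith
  -- The grid point lies after `s` by at most `1 / (n + 1) < ε`, so constancy to the right suffices.
  refine h _ ?_ ?_
  · change s ≤ ((⌊((n : ℝ) + 1) * s⌋₊ : ℝ) + 1) / (n + 1)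
    rw [le_div_iff₀ hn0]; linarith
  · change ((⌊((n : ℝ) + 1) * s⌋₊ : ℝ) + 1) / (n + 1) ≤ s + ε
    rw [div_le_iff₀ hn0]; linarith

/-- Measurability in time comes from the grid: the integrand is a pointwise limit of functions that
factor through the countable grid index. Boundedness comes from the finiteness of `E`. -/
theorem IsRightLocallyConst.intervalIntegrable {E V : Type*} [Finite E] [NormedAddCommGroup V]
    {z : ℝ → E} (hz : IsRightLocallyConst z) (F : E → V) {t : ℝ} (ht : 0 ≤ t) :
    IntervalIntegrable (fun s => F (z s)) volume 0 t := by
  rw [intervalIntegrable_iff_integrableOn_Ioc_of_le ht]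
  obtain ⟨C, hC⟩ := (Set.finite_range fun x => ‖F x‖).bddAbove
  refine Integrable.of_bound ?_ C
    (Eventually.of_forall fun s => hC ⟨z s, rfl⟩)
  refine aestronglyMeasurable_of_tendsto_ae (u := atTop)
    (f := fun n s => F (z (gridTime n (gridIndex n s)))) (fun n => ?_) ?_
  · exact ((StronglyMeasurable.of_discrete (f := fun k => F (z (gridTime n k)))).comp_measurable
      (measurable_gridIndex n)).aestronglyMeasurable
  · refine (ae_restrict_iff' (measurableSet_Ioc (a := (0 : ℝ)) (b := t))).2 (Eventually.of_forall fun s hs => ?_)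
    refine tendsto_const_nhds.congr' ?_
    filter_upwards [hz.eventually_gridTime_eq hs.1] with n hn
    rw [hn]

/-- The displacement up to time `t` of a motion whose velocity is replaced, on each cell of the
grid of mesh `1 / (n + 1)`, by its value at the right end of the cell. -/
noncomputable def gridDisplacement (c : ℝ) (n : ℕ) (p : Ioi (0 : ℝ) → SignType) (t : ℝ) : ℝ :=
  ∫ s in (0 : ℝ)..t, c * (p (gridTime n (gridIndex n s)) : ℝ)

/-- The displacement as a functional of the state path on the positive times. -/
noncomputable def displacement (c : ℝ) (p : Ioi (0 : ℝ) → SignType) (t : ℝ≥0) : ℝ :=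
  limsup (fun n => gridDisplacement c n p t) atTop

/-- The integrand sees the path only through countably many coordinates, hence is jointly measurable
in path and time. -/
theorem measurable_gridDisplacement (c : ℝ) (n : ℕ) (t : ℝ≥0) :
    Measurable fun p => gridDisplacement c n p t := by
  have h1 : Measurable fun q : (Ioi (0 : ℝ) → SignType) × ℕ => q.1 (gridTime n q.2) :=
    measurable_from_prod_countable_left fun k =>
      measurable_pi_apply (gridTime n k)
  have h2 : Measurable fun q : (Ioi (0 : ℝ) → SignType) × ℝ =>
      c * (q.1 (gridTime n (gridIndex n q.2)) : ℝ) := by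
    refine Measurable.const_mul ?_ c
    exact (Measurable.of_discrete (f := fun x : SignType => (x : ℝ))).comp
      (h1.comp (measurable_fst.prodMk ((measurable_gridIndex n).comp measurable_snd)))
  simp only [gridDisplacement, intervalIntegral.integral_of_le t.coe_nonneg]
  exact (h2.stronglyMeasurable.integral_prod_right'
    (ν := volume.restrict (Ioc (0 : ℝ) t))).measurable

theorem measurable_displacement (c : ℝ) : Measurable (displacement c) :=
  measurable_pi_lambda _ fun t => Measurable.limsup fun n => measurable_gridDisplacement c n t

theorem IsRightLocallyConst.displacement_eq {z : ℝ → SignType} (hz : IsRightLocallyConst z) (c : ℝ)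
    (t : ℝ≥0) : displacement c (fun u => z u) t = ∫ s in (0 : ℝ)..t, c * (z s : ℝ) := by
  refine Tendsto.limsup_eq ?_
  refine intervalIntegral.tendsto_integral_filter_of_dominated_convergence (fun _ => |c|)
    (Eventually.of_forall fun n => ?_) (Eventually.of_forall fun n => ?_)
    intervalIntegrable_const ?_
  · exact ((StronglyMeasurable.of_discrete
      (f := fun k => c * (z (gridTime n k) : ℝ))).comp_measurable
      (measurable_gridIndex n)).aestronglyMeasurable
  · refine Eventually.of_forall fun s _ => ?_
    rw [norm_mul, Real.norm_eq_abs, Real.norm_eq_abs]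
    exact mul_le_of_le_one_right (abs_nonneg c) (abs_signContrast_le _)
  · refine Eventually.of_forall fun s hs => ?_
    rw [uIoc_of_le t.coe_nonneg] at hs
    refine tendsto_const_nhds.congr' ?_
    filter_upwards [hz.eventually_gridTime_eq hs.1] with n hn
    rw [hn]

namespace IsPoissonSwitching

variable {Ω E : Type*} [MeasurableSpace Ω] {P : Measure Ω} [IsProbabilityMeasure P] {lam : ℝ → ℝ}
  {init : E → ℝ≥0∞} {sw : E → E → ℝ≥0∞} {S : Ω → Set ℝ} {Z : ℝ → Ω → E}

/-- Away from 0 the mean is finite, so the Poisson masses at the natural numbers sum to 1 and the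
count is almost surely not `∞`. -/
theorem ae_finite_events (hZ : IsPoissonSwitching P lam init sw S Z)
    (hc : ContinuousOn lam (Ioi 0)) (h0 : ∀ t, 0 < t → 0 ≤ lam t) {s t : ℝ} (hs : 0 < s)
    (hst : s ≤ t) : ∀ᵐ ω ∂P, (S ω ∩ Ioc s t).Finite := by
  set G : Set Ω := ⋃ n : ℕ, {ω | eventCount S s t ω = n} with hG
  have hm : ∀ n : ℕ, MeasurableSet {ω | eventCount S s t ω = n} :=
    hZ.measurableSet_count s t hs.le hst
  have hPG : P G = 1 := by
    rw [hG, measure_iUnion _ hm]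
    · have hh := integral_rate_nonneg h0 hs hst
      simp only [hZ.count_law s t hs.le hst, poissonMass,
        cumulativeRate_eq_ofReal hc h0 hs hst, ENNReal.ofReal_ne_top, if_false]
      refine (measure_iUnion (fun m n hmn => disjoint_singleton.2 hmn)
        fun _ => MeasurableSet.of_discrete).symm.trans ?_
      rw [iUnion_of_singleton, measure_univ]
    · intro m n hmn
      refine Set.disjoint_left.2 fun ω h1 h2 => hmn ?_
      exact_mod_cast (h1.symm.trans h2 : (m : ℕ∞) = n)
  have : ∀ᵐ ω ∂P, ω ∈ G := (prob_compl_eq_zero_iff (MeasurableSet.iUnion hm)).2 hPG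
  filter_upwards [this] with ω hω
  obtain ⟨n, hn⟩ := mem_iUnion.1 hω
  exact finite_of_encard_eq_coe hn

theorem ae_isRightLocallyConst (hZ : IsPoissonSwitching P lam init sw S Z)
    (hc : ContinuousOn lam (Ioi 0)) (h0 : ∀ t, 0 < t → 0 ≤ lam t) :
    ∀ᵐ ω ∂P, IsRightLocallyConst fun t => Z t ω := by
  have hfin : ∀ᵐ ω ∂P, ∀ n : ℕ, (S ω ∩ Ioc (1 / ((n : ℝ) + 1)) (n + 1)).Finite := by
    refine ae_all_iff.2 fun n => hZ.ae_finite_events hc h0 (by positivity) ?_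
    have : (0 : ℝ) ≤ n := n.cast_nonneg
    rw [div_le_iff₀ (by positivity)]
    nlinarith
  filter_upwards [hfin, hZ.const_between] with ω hω hcb s hs
  -- This puts `s` inside the window `(1 / (n + 1), n + 1)`; finitely many events there leave a gap
  -- after `s`.
  obtain ⟨n, hn⟩ := exists_nat_gt (max s (1 / s))
  have hn1 : s < n + 1 := ((le_max_left _ _).trans_lt hn).trans (lt_add_one _)
  have hn2 : 1 / ((n : ℝ) + 1) < s := by
    have := (le_max_right s (1 / s)).trans_lt hn
    rw [div_lt_iff₀ hs] at this
    rw [div_lt_iff₀ (by positivity)]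
    nlinarith
  have hfin' : (S ω ∩ Ioc s (n + 1)).Finite :=
    (hω n).subset (inter_subset_inter_right _ (Ioc_subset_Ioc_left hn2.le))
  have hev : ∀ᶠ u in 𝓝 s, u < (n : ℝ) + 1 ∧ ∀ v ∈ S ω ∩ Ioc s (n + 1), u < v :=
    (gt_mem_nhds hn1).and ((Filter.eventually_all_finite hfin').2
      fun v hv => gt_mem_nhds hv.2.1)
  obtain ⟨ε, hε, h⟩ := Metric.eventually_nhds_iff.1 hev
  refine ⟨ε / 2, by positivity, fun u hsu hu => hcb s u hs.le hsu ?_⟩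
  refine eq_empty_of_forall_notMem fun v hv => ?_
  have hd : dist u s < ε := by
    rw [Real.dist_eq, abs_of_nonneg (sub_nonneg.2 hsu)]; linarith
  obtain ⟨h1, h2⟩ := h hd
  exact absurd hv.2.2 (not_le.2 (h2 v ⟨hv.1, hv.2.1, hv.2.2.trans h1.le⟩))

/-- Two displacement processes driven by three-velocity state processes have the same law. -/
theorem identDistrib_displacement {Ω' : Type*} [MeasurableSpace Ω'] {P' : Measure Ω'}
    [IsProbabilityMeasure P'] {S' : Ω' → Set ℝ} {Z : ℝ → Ω → SignType} {Z' : ℝ → Ω' → SignType}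
    (hZ : IsPoissonSwitching P lam threeVelocityInit threeVelocitySwitch S Z)
    (hZ' : IsPoissonSwitching P' lam threeVelocityInit threeVelocitySwitch S' Z')
    (hc : ContinuousOn lam (Ioi 0)) (h0 : ∀ t, 0 < t → 0 ≤ lam t) {c : ℝ} {X : ℝ → Ω → ℝ}
    {X' : ℝ → Ω' → ℝ}
    (hX : ∀ᵐ ω ∂P, ∀ t, 0 ≤ t → X t ω = ∫ s in (0 : ℝ)..t, c * (Z s ω : ℝ))
    (hX' : ∀ᵐ ω ∂P', ∀ t, 0 ≤ t → X' t ω = ∫ s in (0 : ℝ)..t, c * (Z' s ω : ℝ)) :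
    IdentDistrib (fun ω (t : ℝ≥0) => X t ω) (fun ω (t : ℝ≥0) => X' t ω) P P' := by
  have key := (hZ.identDistrib_path hZ' hc h0).comp (measurable_displacement c)
  have e : (displacement c ∘ fun ω (t : Ioi (0 : ℝ)) => Z t ω) =ᵐ[P]
      fun ω (t : ℝ≥0) => X t ω := by
    filter_upwards [hX, hZ.ae_isRightLocallyConst hc h0] with ω h1 h2
    funext t
    exact (h2.displacement_eq c t).trans (h1 t t.2).symm
  have e' : (displacement c ∘ fun ω (t : Ioi (0 : ℝ)) => Z' t ω) =ᵐ[P']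
      fun ω (t : ℝ≥0) => X' t ω := by
    filter_upwards [hX', hZ'.ae_isRightLocallyConst hc h0] with ω h1 h2
    funext t
    exact (h2.displacement_eq c t).trans (h1 t t.2).symm
  exact ((IdentDistrib.of_ae_eq key.aemeasurable_fst e).symm.trans key).trans
    (IdentDistrib.of_ae_eq key.aemeasurable_snd e')

end IsPoissonSwitching

/-! ### Projection of the four directions onto the axes -/

/-- The horizontal component of a direction, as a sign. -/
def horizontalSign (k : ZMod 4) : SignType := if k = 0 then 1 else if k = 2 then -1 else 0

/-- The vertical component of a direction, as a sign. -/
def verticalSign (k : ZMod 4) : SignType := if k = 1 then 1 else if k = 3 then -1 else 0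

theorem direction_eq (k : ZMod 4) :
    direction k = ((horizontalSign k : ℝ), (verticalSign k : ℝ)) := by
  have e2 : (2 : ℝ) * Real.pi / 2 = Real.pi := by ring
  have e3 : (3 : ℝ) * Real.pi / 2 = Real.pi / 2 + Real.pi := by ring
  have v2 : (2 : ZMod 4).val = 2 := rfl
  have v3 : (3 : ZMod 4).val = 3 := rfl
  have v1 : (1 : ZMod 4).val = 1 := rfl
  have d : (2 : ZMod 4) ≠ 0 ∧ (3 : ZMod 4) ≠ 0 ∧ (3 : ZMod 4) ≠ 2 ∧ (3 : ZMod 4) ≠ 1 ∧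
    (1 : ZMod 4) ≠ 2 ∧ (1 : ZMod 4) ≠ 0 ∧ (0 : ZMod 4) ≠ 3 ∧ (0 : ZMod 4) ≠ 1 ∧
    (2 : ZMod 4) ≠ 1 ∧ (2 : ZMod 4) ≠ 3 := by decide
  have hk : k = 0 ∨ k = 1 ∨ k = 2 ∨ k = 3 := by revert k; decide
  rcases hk with rfl | rfl | rfl | rfl
  · simp [direction, horizontalSign, verticalSign, d]
  · simp [direction, horizontalSign, verticalSign, d, v1]
  · simp [direction, horizontalSign, verticalSign, d, v2, e2]
  · simp [direction, horizontalSign, verticalSign, d, v3, e3, Real.cos_add_pi, Real.sin_add_pi]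

theorem threeVelocityInit_eq_sum {π : ZMod 4 → SignType}
    (hπ : ∀ x, (Finset.univ.filter fun k => π k = x).card = if x = 0 then 2 else 1)
    (x : SignType) : threeVelocityInit x = ∑ k, if π k = x then 1 / 4 else 0 := by
  rw [← Finset.sum_filter, Finset.sum_const, hπ, threeVelocityInit]
  split_ifs
  · rw [nsmul_eq_mul, Nat.cast_ofNat, ← mul_div_assoc, mul_one,
      ENNReal.div_eq_div_iff] <;> norm_num
  · simp

/-- The hypothesis counts the neighbours of `k` in each fibre, a finite statement that `decide`
settles for both coordinates. -/
theorem threeVelocitySwitch_eq_sum {π : ZMod 4 → SignType}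
    (hπ : ∀ k y, (Finset.univ.filter fun l => π l = y ∧ (l = k + 1 ∨ l = k - 1)).card =
      if π k = 0 then (if y = 0 then 0 else 1) else (if y = 0 then 2 else 0))
    (k : ZMod 4) (y : SignType) :
    threeVelocitySwitch (π k) y = ∑ l, if π l = y then orthogonalSwitch k l else 0 := by
  simp only [orthogonalSwitch, ← ite_and]
  rw [← Finset.sum_filter, Finset.sum_const, hπ, threeVelocitySwitch]
  split_ifs
  · simp
  · simp
  · rw [nsmul_eq_mul, Nat.cast_ofNat, one_div, ENNReal.mul_inv_cancel] <;> norm_num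
  · simp

end OrthogonalMotion

theorem mainTheorem6 {Ω : Type*} [MeasurableSpace Ω] (P : Measure Ω) [IsProbabilityMeasure P]
    {Ω' : Type*} [MeasurableSpace Ω'] (P' : Measure Ω') [IsProbabilityMeasure P']
    (c : ℝ) (hc : 0 < c) (lam : ℝ → ℝ) (hlam : ContDiffOn ℝ 2 lam (Ioi 0))
    (hlam_nonneg : ∀ t, 0 < t → 0 ≤ lam t)
    (R : ℝ → Ω → ℝ × ℝ) (hR : OrthogonalMotion.IsStandardOrthogonalMotion P c lam R)
    (T : ℝ → Ω' → ℝ) (hT : OrthogonalMotion.IsThreeVelocityMotion P' c lam T) :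
    IdentDistrib (fun ω (t : ℝ≥0) => (R t ω).1) (fun ω (t : ℝ≥0) => T t ω) P P' ∧
      IdentDistrib (fun ω (t : ℝ≥0) => (R t ω).2) (fun ω (t : ℝ≥0) => T t ω) P P' := by
  obtain ⟨S, D, hD, hRD⟩ := hR
  obtain ⟨S', σ, hσ, hTσ⟩ := hT
  have hcont := hlam.continuousOn
  have hrc := hD.ae_isRightLocallyConst hcont hlam_nonneg
  -- Integrability is needed to take a coordinate inside the vector-valued integral.
  have hint : ∀ ω, OrthogonalMotion.IsRightLocallyConst (fun t => D t ω) → ∀ t, 0 ≤ t →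
      IntervalIntegrable (fun s => c • OrthogonalMotion.direction (D s ω)) volume 0 t :=
    fun ω hω t ht => hω.intervalIntegrable (fun k => c • OrthogonalMotion.direction k) ht
  constructor
  · refine (hD.map OrthogonalMotion.horizontalSign
      (OrthogonalMotion.threeVelocityInit_eq_sum (by decide))
      (OrthogonalMotion.threeVelocitySwitch_eq_sum (by decide))).identDistrib_displacement hσ hcont
      hlam_nonneg (X := fun t ω => (R t ω).1) ?_ hTσ
    filter_upwards [hRD, hrc] with ω h1 h2 t ht
    rw [h1 t ht]
    have := (ContinuousLinearMap.fst ℝ ℝ ℝ).intervalIntegral_comp_comm (hint ω h2 t ht)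
    rw [ContinuousLinearMap.coe_fst'] at this
    rw [← this]
    simp [OrthogonalMotion.direction_eq]
  · refine (hD.map OrthogonalMotion.verticalSign
      (OrthogonalMotion.threeVelocityInit_eq_sum (by decide))
      (OrthogonalMotion.threeVelocitySwitch_eq_sum (by decide))).identDistrib_displacement hσ hcont
      hlam_nonneg (X := fun t ω => (R t ω).2) ?_ hTσ
    filter_upwards [hRD, hrc] with ω h1 h2 t ht
    rw [h1 t ht]
    have := (ContinuousLinearMap.snd ℝ ℝ ℝ).intervalIntegral_comp_comm (hint ω h2 t ht)
    rw [ContinuousLinearMap.coe_snd'] at this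
    rw [← this]
    simp [OrthogonalMotion.direction_eq]
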